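/- Theorem 5.4. For sets $A, B \subseteq \mathbb{N}$ write $A \subseteq^* B$ if $A \setminus B$ is finite. Let $\langle x, n\rangle$ denote the Cantor pairing function $\mathbb{N} \times \mathbb{N} \to \mathbb{N}$, $\langle x, n\rangle = \frac{(x+n)(x+n+1)}{2} + n$, and for $F \subseteq \mathbb{N}$ and $n \in \mathbb{N}$ let $F_n = \{u \in \mathbb{N} : \langle u, n\rangle \in F\}$. There is a set $F \subseteq \mathbb{N}$ whose complement is computably enumerable and which is an ultrafilter base for the Boolean algebra of computable sets, that is: 1. $F_n$ is computable for each $n$; 2. $F_0 = \mathbb{N}$, and for each $n$, $F_{n+1} \subseteq^* F_n$ and $F_n \setminus F_{n+1}$ is infinite; 3. for each computable set $R \subseteq \mathbb{N}$ there is $n$ such that $F_n \subseteq^* R$ or $F_n \subseteq^* \mathbb{N} \setminus R$. -/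

import Mathlib

namespace UltrafilterBase

/-- Almost inclusion `A ⊆* B`: all but finitely many elements of `A` are in `B`. -/
def AlmostSubset (A B : Set ℕ) : Prop := (A \ B).Finite

/-- The Cantor pairing function, a bijection from `ℕ × ℕ` onto `ℕ`. -/
def cantorPair (x n : ℕ) : ℕ := (x + n) * (x + n + 1) / 2 + n

/-- The `n`-th column `X_n = {u : ⟨u, n⟩ ∈ X}` of a set `X`. -/
def column (X : Set ℕ) (n : ℕ) : Set ℕ := {u | cantorPair u n ∈ X}

/-- The class of all computable sets of natural numbers. -/
def computableSets : Set (Set ℕ) := {R | ComputablePred (fun x : ℕ => x ∈ R)}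

/-- A set is co-c.e. if its complement is computably enumerable. -/
def IsCoCE (X : Set ℕ) : Prop := REPred (fun x : ℕ => x ∈ Xᶜ)

/-- `G` is (a code for) a `𝔹`-tower: its columns are sets in `𝔹`, the column with index `0` is
all of `ℕ`, and the columns are strictly decreasing with respect to almost inclusion. -/
structure IsTower (𝔹 : Set (Set ℕ)) (G : Set ℕ) : Prop where
  mem : ∀ n, column G n ∈ 𝔹
  zero : column G 0 = Set.univ
  almostSubset : ∀ n, AlmostSubset (column G (n + 1)) (column G n)
  infinite_diff : ∀ n, (column G n \ column G (n + 1)).Infinite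

/-- `F` is (a code for) a `𝔹`-ultrafilter base: a `𝔹`-tower such that each set in `𝔹` or its
complement almost contains some column of `F`. -/
structure IsUltrafilterBase (𝔹 : Set (Set ℕ)) (F : Set ℕ) : Prop where
  isTower : IsTower 𝔹 F
  decides : ∀ R ∈ 𝔹, ∃ n, AlmostSubset (column F n) Rᶜ ∨ AlmostSubset (column F n) R

end UltrafilterBase

/-!
There is an obvious tower of infinite computable sets deciding all computable sets: start with `ℕ`,
and at level `k` pass to the elements of even rank with value `1` under the `k`-th partial computable
function if these can be enumerated forever, and to all elements of even rank otherwise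
(`truePath`, `exists_pathFun_decides`). Each set is given by a strictly increasing computable
enumeration, hence is computable, but which case applies at each level is not decidable.

To obtain uniformly co-c.e. sets, one runs through all guesses `(σ, k, i)`, where `σ` guesses the
first `k` decisions, and `i` bounds a point at which each enumeration declared partial by `σ`
diverges. The second part makes incorrectness on that side observable at a finite stage. At stage `s`
a guess removes `x` if its enumerations converge up to rank `x`, `x` is not listed, and the
enumerations declared partial have not yet converged up to `i` (`Removes`). A correct guess removes
exactly the complement of the `k`-th set (`Correct.removes_iff`). An incorrect one removes only
finitely many numbers (`finite_of_not_correct`). So the intersection `baseSet n` of the sets left by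
the first `n` guesses agrees, up to a finite set, with the set of the largest level guessed correctly
so far (`exists_baseSet_eq`).

The largest level may stay the same when `n` increases, while strict descent is required at each
step. Therefore the guesses numbered below `n` do not aim at the `k`-th set itself but at its `n`-th
intermediate set `pathSet k n`, obtained by keeping all even ranks and, as `n` grows, ever fewer odd
ranks. Since level `k + 1` lies in the even ranks of level `k`, it is below all of these
(`pathSet_antitone_level`), and the descent is infinite at each step whether or not the level
changes (`infinite_baseSet_diff`).
-/

namespace UltrafilterBase

open Nat.Partrec (Code)
open Nat.Partrec.Code (eval evaln)

/-! ### Primitive recursive, computable and recursively enumerable predicates -/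

/-- `PrimrecRel.exists_lt` with a parameter of arbitrary type. -/
theorem primrecRel_exists_lt {α : Type*} [Primcodable α] {R : ℕ → α → Prop} (hR : PrimrecRel R) :
    PrimrecRel fun n a => ∃ r < n, R r a :=
  (hR.exists_mem_list.comp (Primrec.list_range.comp Primrec.fst) Primrec.snd).of_eq (by simp)

/-- `PrimrecRel.forall_lt` with a parameter of arbitrary type. -/
theorem primrecRel_forall_lt {α : Type*} [Primcodable α] {R : ℕ → α → Prop} (hR : PrimrecRel R) :
    PrimrecRel fun n a => ∀ r < n, R r a :=
  (hR.forall_mem_list.comp (Primrec.list_range.comp Primrec.fst) Primrec.snd).of_eq (by simp)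

theorem rePred_exists_nat {α : Type*} [Primcodable α] {P : α → ℕ → Prop}
    (hP : PrimrecRel P) : REPred fun a => ∃ n, P a n := by
  classical
  have h : Partrec fun a => Nat.rfind fun n => Part.some (decide (P a n)) :=
    Partrec.rfind hP.decide.to_comp.partrec
  refine h.dom_re.of_eq fun a => ?_
  refine Nat.rfind_dom.trans ?_
  simp

theorem computablePred_of_finite_diff {A B : Set ℕ} (hA : ComputablePred (· ∈ A))
    (h₁ : (A \ B).Finite) (h₂ : (B \ A).Finite) : ComputablePred (· ∈ B) := by
  classical
  have fin_computable : ∀ S : Finset ℕ, Computable fun x : ℕ => decide (x ∈ S) := fun S =>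
    (((Primrec.eq (α := ℕ)).exists_mem_list.comp (Primrec.const S.toList) Primrec.id).of_eq
      fun x => by simp).decide.to_comp
  have hA' : Computable fun x : ℕ => decide (x ∈ A) := hA.decide
  have key : Computable fun x : ℕ =>
      (decide (x ∈ A) && !decide (x ∈ h₁.toFinset)) || decide (x ∈ h₂.toFinset) :=
    Primrec.or.to_comp.comp
      (Primrec.and.to_comp.comp hA' (Primrec.not.to_comp.comp (fin_computable _)))
      (fin_computable _)
  refine Computable.computablePred (key.of_eq fun x => ?_)
  by_cases hxA : x ∈ A <;> by_cases hxB : x ∈ B <;> simp [hxA, hxB]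

/-! ### Infinite subsets of an enumerated set -/

/-- The partial test whether the element of even rank `2 * q` in the enumeration `p` is given the
value `1` by the `e`-th partial computable function. -/
def hit (p : Code) (e q : ℕ) : Part Bool :=
  (eval p (2 * q)).bind fun x => (eval (Denumerable.ofNat Code e) x).map fun y => decide (y = 1)

/-- The least `q ≥ a` passing the test `hit p e`, provided all tests up to it converge. -/
def nextHit (p : Code) (e a : ℕ) : Part ℕ :=
  (Nat.rfind fun d => hit p e (a + d)).map (a + ·)

/-- The `r`-th number passing the test `hit p e`. -/
def nthHit (p : Code) (e : ℕ) : ℕ → Part ℕ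
  | 0 => nextHit p e 0
  | r + 1 => (nthHit p e r).bind fun q => nextHit p e (q + 1)

/-- Enumeration of those elements of even rank in the enumeration `p` to which the `e`-th partial
computable function gives the value `1`. -/
def hitEnum (p : Code) (e r : ℕ) : Part ℕ := (nthHit p e r).bind fun q => eval p (2 * q)

theorem hit_partrec : Partrec fun a : (Code × ℕ) × ℕ => hit a.1.1 a.1.2 a.2 := by
  have h2 : Computable fun a : (Code × ℕ) × ℕ => 2 * a.2 :=
    (Primrec.nat_mul.comp (Primrec.const 2) Primrec.snd).to_comp
  refine (Nat.Partrec.Code.eval_part.comp (Computable.fst.comp Computable.fst) h2).bind ?_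
  refine Partrec.map (Nat.Partrec.Code.eval_part.comp
    ((Computable.ofNat Code).comp (Computable.snd.comp (Computable.fst.comp Computable.fst)))
    Computable.snd) ?_
  exact ((Primrec.eq.comp Primrec.snd (Primrec.const 1)).decide).to_comp.to₂

theorem nextHit_partrec : Partrec fun a : (Code × ℕ) × ℕ => nextHit a.1.1 a.1.2 a.2 := by
  refine Partrec.map (Partrec.rfind ?_)
    (Primrec.nat_add.comp (Primrec.snd.comp Primrec.fst) Primrec.snd).to_comp.to₂
  exact (hit_partrec.comp ((Computable.fst.comp Computable.fst).pair
    (Primrec.nat_add.comp (Primrec.snd.comp Primrec.fst) Primrec.snd).to_comp)).to₂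

theorem nthHit_partrec : Partrec fun a : (Code × ℕ) × ℕ => nthHit a.1.1 a.1.2 a.2 := by
  have h0 : Partrec fun a : (Code × ℕ) × ℕ => nextHit a.1.1 a.1.2 0 :=
    nextHit_partrec.comp (g := fun a : (Code × ℕ) × ℕ => (a.1, 0))
      (Computable.fst.pair (Computable.const 0))
  have h1 : Computable fun b : ((Code × ℕ) × ℕ) × (ℕ × ℕ) => (b.1.1, b.2.2 + 1) :=
    (Computable.fst.comp Computable.fst).pair
      (Computable.succ.comp (Computable.snd.comp Computable.snd))
  have h2 := nextHit_partrec.comp h1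
  have key : ∀ p e r, nthHit p e r = Nat.rec (motive := fun _ => Part ℕ) (nextHit p e 0)
      (fun _ ih => ih.bind fun q => nextHit p e (q + 1)) r := fun p e r => by
    induction r with
    | zero => rfl
    | succ r ih => rw [nthHit, ih]
  simp only [key]
  exact Partrec.nat_rec (f := fun a : (Code × ℕ) × ℕ => a.2)
    (h := fun (a : (Code × ℕ) × ℕ) (b : ℕ × ℕ) => nextHit a.1.1 a.1.2 (b.2 + 1))
    Computable.snd h0 h2

theorem hitEnum_partrec : Partrec fun a : (Code × ℕ) × ℕ => hitEnum a.1.1 a.1.2 a.2 :=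
  nthHit_partrec.bind (Nat.Partrec.Code.eval_part.comp
    (Computable.fst.comp (Computable.fst.comp Computable.fst))
    (Primrec.nat_mul.comp (Primrec.const 2) Primrec.snd).to_comp).to₂

theorem exists_hitCode : ∃ c : Code → ℕ → Code, Primrec₂ c ∧
    ∀ p e r, eval (c p e) r = hitEnum p e r := by
  have h : Partrec fun n : ℕ =>
      hitEnum (Denumerable.ofNat ((Code × ℕ) × ℕ) n).1.1 (Denumerable.ofNat ((Code × ℕ) × ℕ) n).1.2
        (Denumerable.ofNat ((Code × ℕ) × ℕ) n).2 := hitEnum_partrec.comp (Computable.ofNat _)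
  obtain ⟨u, hu⟩ := Nat.Partrec.Code.exists_code.1 (Partrec.nat_iff.1 h)
  refine ⟨fun p e => u.curry (Encodable.encode (p, e)),
    Nat.Partrec.Code.primrec₂_curry.comp (Primrec.const u) Primrec.encode, fun p e r => ?_⟩
  have hp : Nat.pair (Encodable.encode (p, e)) r = Encodable.encode ((p, e), r) := by simp
  rw [Nat.Partrec.Code.eval_curry, hu, hp]
  simp only [Denumerable.ofNat_encode]

/-- A code for `hitEnum p e`. -/
noncomputable def hitCode : Code → ℕ → Code := exists_hitCode.choose

theorem hitCode_primrec : Primrec₂ hitCode := exists_hitCode.choose_spec.1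

theorem eval_hitCode (p : Code) (e r : ℕ) : eval (hitCode p e) r = hitEnum p e r :=
  exists_hitCode.choose_spec.2 p e r

theorem exists_evenCode : ∃ c : Code → Code, Primrec c ∧ ∀ p r, eval (c p) r = eval p (2 * r) := by
  have h : Computable fun r : ℕ => 2 * r :=
    (Primrec.nat_mul.comp (Primrec.const 2) Primrec.id).to_comp
  obtain ⟨d, hd⟩ := Nat.Partrec.Code.exists_code.1 (Partrec.nat_iff.1 h.partrec)
  refine ⟨fun p => p.comp d, Nat.Partrec.Code.primrec₂_comp.comp Primrec.id (Primrec.const d),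
    fun p r => ?_⟩
  simp only [eval, hd]
  exact Part.bind_some _ _

/-- A code enumerating the elements of even rank in the enumeration `p`. -/
noncomputable def evenCode : Code → Code := exists_evenCode.choose

theorem evenCode_primrec : Primrec evenCode := exists_evenCode.choose_spec.1

theorem eval_evenCode (p : Code) (r : ℕ) : eval (evenCode p) r = eval p (2 * r) :=
  exists_evenCode.choose_spec.2 p r

/-- The code `p` computes a total strictly increasing function `f`. -/
def Enumerates (p : Code) (f : ℕ → ℕ) : Prop := StrictMono f ∧ ∀ r, eval p r = Part.some (f r)

theorem Enumerates.evenCode {p : Code} {f : ℕ → ℕ} (h : Enumerates p f) :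
    Enumerates (evenCode p) fun r => f (2 * r) :=
  ⟨fun a b hab => h.1 (by omega), fun r => by rw [eval_evenCode, h.2]⟩

theorem mem_nextHit {p : Code} {e a q : ℕ} (h : q ∈ nextHit p e a) : a ≤ q ∧ true ∈ hit p e q := by
  obtain ⟨d, hd, rfl⟩ := (Part.mem_map_iff _).1 h
  exact ⟨Nat.le_add_right a d, Nat.rfind_spec (p := fun d => hit p e (a + d)) hd⟩

theorem true_mem_hit {p : Code} {e q : ℕ} {f : ℕ → ℕ} (h : Enumerates p f) :
    true ∈ hit p e q ↔ 1 ∈ eval (Denumerable.ofNat Code e) (f (2 * q)) := by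
  simp [hit, h.2]

/-- If the elements of even rank with value `1` can be enumerated forever, they form an infinite
set enumerated in increasing order. -/
theorem Enumerates.hitCode {p : Code} {f : ℕ → ℕ} {e : ℕ} (h : Enumerates p f)
    (ht : ∀ r, (eval (hitCode p e) r).Dom) :
    ∃ g : ℕ → ℕ, Enumerates (hitCode p e) (fun r => f (2 * g r)) ∧
      ∀ r, 1 ∈ eval (Denumerable.ofNat Code e) (f (2 * g r)) := by
  have hd : ∀ r, (nthHit p e r).Dom := fun r => by
    have := ht r
    rw [eval_hitCode] at this
    exact this.1
  choose g hg using fun r => Part.dom_iff_mem.1 (hd r)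
  have hstep : ∀ r, g (r + 1) ∈ nextHit p e (g r + 1) := fun r => by
    have := hg (r + 1)
    rwa [nthHit, Part.eq_some_iff.2 (hg r), Part.bind_some] at this
  have hmono : StrictMono g := strictMono_nat_of_lt_succ fun r => (mem_nextHit (hstep r)).1
  refine ⟨g, ⟨fun a b hab => h.1 (by have := hmono hab; omega), fun r => ?_⟩, fun r => ?_⟩
  · rw [eval_hitCode, hitEnum, Part.eq_some_iff.2 (hg r), Part.bind_some, h.2]
  · rw [← true_mem_hit h]
    cases r with
    | zero => exact (mem_nextHit (hg 0)).2
    | succ r => exact (mem_nextHit (hstep r)).2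

/-- If the `e`-th partial computable function is total and the enumeration of the elements of even
rank with value `1` gets stuck, there are only finitely many such elements. -/
theorem finite_of_not_total {p : Code} {f : ℕ → ℕ} {e : ℕ} (h : Enumerates p f)
    (he : ∀ x, (eval (Denumerable.ofNat Code e) x).Dom)
    (ht : ¬ ∀ r, (eval (hitCode p e) r).Dom) :
    {q | 1 ∈ eval (Denumerable.ofNat Code e) (f (2 * q))}.Finite := by
  by_contra hinf
  refine ht fun r => ?_
  have hnext : ∀ a, (nextHit p e a).Dom := fun a => by
    obtain ⟨q, hq, haq⟩ := Set.Infinite.exists_gt hinf a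
    change (Nat.rfind fun d => hit p e (a + d)).Dom
    refine Nat.rfind_dom.2 ⟨q - a, ?_, fun {m} _ => ?_⟩
    · rw [Nat.add_sub_cancel' haq.le]
      exact (true_mem_hit h).2 hq
    · simp only [hit, h.2, Part.bind_some]
      exact he _
  have hd : (nthHit p e r).Dom := by
    induction r with
    | zero => exact hnext 0
    | succ r ih => exact Part.bind_dom.2 ⟨ih, hnext _⟩
  rw [eval_hitCode]
  refine Part.bind_dom.2 ⟨hd, ?_⟩
  rw [h.2]
  trivial

/-! ### The true path -/

open Classical in
/-- The enumerations along the true path. At level `k` the enumerated set is thinned to its elements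
of even rank, and among these to the ones with value `1` under the `k`-th partial computable
function whenever that leaves infinitely many of them, effectively enumerated. -/
noncomputable def truePath : ℕ → Code
  | 0 => Code.id
  | k + 1 => if ∀ r, (eval (hitCode (truePath k) k) r).Dom then hitCode (truePath k) k
      else evenCode (truePath k)

theorem exists_enumerates_truePath (k : ℕ) : ∃ f, Enumerates (truePath k) f := by
  induction k with
  | zero => exact ⟨id, strictMono_id, Nat.Partrec.Code.eval_id⟩
  | succ k ih =>
    obtain ⟨f, hf⟩ := ih
    rw [truePath]
    split_ifs with h
    · obtain ⟨g, hg, -⟩ := hf.hitCode h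
      exact ⟨_, hg⟩
    · exact ⟨_, hf.evenCode⟩

/-- The increasing function computed by `truePath k`. -/
noncomputable def pathFun (k : ℕ) : ℕ → ℕ := (exists_enumerates_truePath k).choose

theorem enumerates_pathFun (k : ℕ) : Enumerates (truePath k) (pathFun k) :=
  (exists_enumerates_truePath k).choose_spec

theorem Enumerates.unique {p : Code} {f g : ℕ → ℕ} (hf : Enumerates p f) (hg : Enumerates p g) :
    f = g :=
  funext fun r => Part.some_inj.1 ((hf.2 r).symm.trans (hg.2 r))

theorem pathFun_zero : pathFun 0 = id :=
  (enumerates_pathFun 0).unique ⟨strictMono_id, Nat.Partrec.Code.eval_id⟩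

theorem exists_pathFun_succ_eq (k r : ℕ) : ∃ q, pathFun (k + 1) r = pathFun k (2 * q) := by
  have h := enumerates_pathFun (k + 1)
  rw [truePath] at h
  split_ifs at h with ht
  · obtain ⟨g, hg, -⟩ := (enumerates_pathFun k).hitCode ht
    exact ⟨g r, congrFun (h.unique hg) r⟩
  · exact ⟨r, congrFun (h.unique (enumerates_pathFun k).evenCode) r⟩

theorem range_pathFun_antitone {k l : ℕ} (h : k ≤ l) :
    Set.range (pathFun l) ⊆ Set.range (pathFun k) := by
  induction l, h using Nat.le_induction with
  | base => exact subset_rfl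
  | succ l _ ih =>
    refine Set.Subset.trans ?_ ih
    rintro _ ⟨r, rfl⟩
    obtain ⟨q, hq⟩ := exists_pathFun_succ_eq l r
    exact ⟨_, hq.symm⟩

/-- The true path decides every computable set, at the level following its index: either this level
lists elements of the set only, or the previous level has only finitely many of even rank. -/
theorem exists_pathFun_decides {R : Set ℕ} (hR : ComputablePred (· ∈ R)) :
    ∃ k, (Set.range (pathFun k) \ Rᶜ).Finite ∨ (Set.range (pathFun k) \ R).Finite := by
  classical
  have hc : Computable fun x : ℕ => cond (decide (x ∈ R)) 1 0 :=
    Computable.cond hR.decide (Computable.const 1) (Computable.const 0)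
  obtain ⟨c, hc⟩ := Nat.Partrec.Code.exists_code.1 (Partrec.nat_iff.1 hc.partrec)
  set e := Encodable.encode c with he
  have hev : ∀ x, eval (Denumerable.ofNat Code e) x = Part.some (cond (decide (x ∈ R)) 1 0) :=
    fun x => by rw [he, Denumerable.ofNat_encode, hc]; rfl
  have h1 : ∀ x, 1 ∈ eval (Denumerable.ofNat Code e) x ↔ x ∈ R := fun x => by
    rw [hev]
    by_cases hx : x ∈ R <;> simp [hx]
  have hp := enumerates_pathFun e
  have h := enumerates_pathFun (e + 1)
  refine ⟨e + 1, ?_⟩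
  rw [truePath] at h
  split_ifs at h with ht
  · right
    obtain ⟨g, hg, hgR⟩ := hp.hitCode ht
    convert! Set.finite_empty
    rw [Set.sdiff_eq_empty, h.unique hg]
    rintro _ ⟨r, rfl⟩
    exact (h1 _).1 (hgR r)
  · left
    have hfin := finite_of_not_total hp (fun x => by rw [hev]; trivial) ht
    refine (hfin.image fun q => pathFun e (2 * q)).subset ?_
    rw [h.unique hp.evenCode]
    rintro _ ⟨⟨q, rfl⟩, hq⟩
    exact ⟨q, (h1 _).2 (not_not.1 hq), rfl⟩

/-! ### Intermediate sets between consecutive levels -/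

/-- The ranks kept in the `n`-th intermediate set: all even ones, and those odd ones `2 * q + 1` for
which the first component of the pair coded by `q` is at least `n`. Passing from `n` to `n + 1` thus
loses infinitely many odd ranks. -/
def Kept (n r : ℕ) : Prop := r % 2 = 0 ∨ n ≤ (Nat.unpair (r / 2)).1

theorem Kept.of_succ {n r : ℕ} (h : Kept (n + 1) r) : Kept n r := h.imp_right fun h => by omega

theorem kept_zero (r : ℕ) : Kept 0 r := Or.inr (Nat.zero_le _)

theorem kept_primrec : PrimrecRel Kept := by
  refine PrimrecPred.or ?_ ?_
  · exact Primrec.eq.comp (Primrec.nat_mod.comp Primrec.snd (Primrec.const 2)) (Primrec.const 0)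
  · exact Primrec.nat_le.comp Primrec.fst (Primrec.fst.comp
      (Primrec.unpair.comp (Primrec.nat_div.comp Primrec.snd (Primrec.const 2))))

/-- The elements of the `k`-th set of the true path whose ranks are kept in the `n`-th intermediate
set. -/
def pathSet (k n : ℕ) : Set ℕ := pathFun k '' {r | Kept n r}

theorem pathSet_subset_range (k n : ℕ) : pathSet k n ⊆ Set.range (pathFun k) :=
  Set.image_subset_range _ _

/-- Level `k + 1` uses even ranks of level `k` only, so it lies below every intermediate set of
level `k`. -/
theorem pathSet_antitone_level {k l n : ℕ} (h : k ≤ l) : pathSet l n ⊆ pathSet k n := by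
  obtain rfl | h := h.eq_or_lt
  · exact subset_rfl
  · intro x hx
    obtain ⟨r, rfl⟩ := range_pathFun_antitone (Nat.succ_le_of_lt h) (pathSet_subset_range _ _ hx)
    obtain ⟨q, hq⟩ := exists_pathFun_succ_eq k r
    exact ⟨2 * q, Or.inl (Nat.mul_mod_right 2 q), hq.symm⟩

theorem infinite_pathSet_diff (k n : ℕ) : (pathSet k n \ pathSet k (n + 1)).Infinite := by
  have hinj := (enumerates_pathFun k).1.injective
  have h2 : ∀ t, (2 * Nat.pair n t + 1) / 2 = Nat.pair n t := fun t => by omega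
  refine Set.infinite_of_injective_forall_mem (f := fun t => pathFun k (2 * Nat.pair n t + 1))
    (fun a b hab => ?_) fun t => ⟨⟨_, Or.inr ?_, rfl⟩, ?_⟩
  · have := hinj hab
    exact (Nat.pair_eq_pair.1 (by omega : Nat.pair n a = Nat.pair n b)).2
  · rw [h2, Nat.unpair_pair]
  · rintro ⟨r, hr, hrt⟩
    obtain rfl := hinj hrt
    rcases hr with hr | hr
    · omega
    · rw [h2, Nat.unpair_pair] at hr
      simp at hr

/-! ### Stagewise approximation -/

/-- The computation `c` converges on all arguments up to `i` within `s` steps. -/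
def HaltsUpTo (s : ℕ) (c : Code) (i : ℕ) : Prop := ∀ r < i + 1, (evaln s c r).isSome = true

theorem HaltsUpTo.mono {s t : ℕ} {c : Code} {i j : ℕ} (h : HaltsUpTo s c i) (hst : s ≤ t)
    (hji : j ≤ i) : HaltsUpTo t c j := fun r hr => by
  obtain ⟨y, hy⟩ := Option.isSome_iff_exists.1 (h r (by omega))
  exact Option.isSome_iff_exists.2 ⟨y, Nat.Partrec.Code.evaln_mono hst hy⟩

theorem HaltsUpTo.lt {s : ℕ} {c : Code} {i : ℕ} (h : HaltsUpTo s c i) : i < s := by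
  obtain ⟨y, hy⟩ := Option.isSome_iff_exists.1 (h i (by omega))
  exact Nat.Partrec.Code.evaln_bound hy

theorem HaltsUpTo.dom {s : ℕ} {c : Code} {i r : ℕ} (h : HaltsUpTo s c i) (hr : r ≤ i) :
    (eval c r).Dom := by
  obtain ⟨y, hy⟩ := Option.isSome_iff_exists.1 (h r (by omega))
  exact Part.dom_iff_mem.2 ⟨y, Nat.Partrec.Code.evaln_sound hy⟩

theorem exists_haltsUpTo {c : Code} {i : ℕ} (h : ∀ r ≤ i, (eval c r).Dom) :
    ∃ s, HaltsUpTo s c i := by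
  induction i with
  | zero =>
    obtain ⟨y, hy⟩ := Part.dom_iff_mem.1 (h 0 le_rfl)
    obtain ⟨s, hs⟩ := Nat.Partrec.Code.evaln_complete.1 hy
    refine ⟨s, fun r hr => ?_⟩
    obtain rfl : r = 0 := by omega
    exact Option.isSome_iff_exists.2 ⟨y, hs⟩
  | succ i ih =>
    obtain ⟨s, hs⟩ := ih fun r hr => h r (by omega)
    obtain ⟨y, hy⟩ := Part.dom_iff_mem.1 (h (i + 1) le_rfl)
    obtain ⟨t, ht⟩ := Nat.Partrec.Code.evaln_complete.1 hy
    refine ⟨max s t, fun r hr => ?_⟩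
    obtain hr | rfl : r < i + 1 ∨ r = i + 1 := by omega
    · exact hs.mono (le_max_left _ _) le_rfl r hr
    · exact Option.isSome_iff_exists.2
        ⟨y, Nat.Partrec.Code.evaln_mono (le_max_right _ _) ht⟩

theorem haltsUpTo_primrec : PrimrecPred fun a : (ℕ × Code) × ℕ => HaltsUpTo a.1.1 a.1.2 a.2 := by
  have h : PrimrecRel fun (r : ℕ) (a : ℕ × Code) => (evaln a.1 a.2 r).isSome = true :=
    Primrec.eq.comp (Primrec.option_isSome.comp (Nat.Partrec.Code.primrec_evaln.comp
      (Primrec.snd.pair Primrec.fst))) (Primrec.const true)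
  exact (primrecRel_forall_lt h).comp (Primrec.succ.comp Primrec.snd) Primrec.fst

/-- Within `s` steps, `x` is seen to be enumerated by `c` at a rank `r ≤ x` kept in the `n`-th
intermediate set. -/
def SeenKept (s : ℕ) (c : Code) (n x : ℕ) : Prop := ∃ r < x + 1, Kept n r ∧ evaln s c r = some x

theorem seenKept_primrec :
    PrimrecPred fun a : (ℕ × Code) × (ℕ × ℕ) => SeenKept a.1.1 a.1.2 a.2.1 a.2.2 := by
  have h : PrimrecRel fun (r : ℕ) (a : (ℕ × Code) × (ℕ × ℕ)) =>
      Kept a.2.1 r ∧ evaln a.1.1 a.1.2 r = some a.2.2 := by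
    refine PrimrecPred.and ?_ ?_
    · exact kept_primrec.comp (Primrec.fst.comp (Primrec.snd.comp Primrec.snd)) Primrec.fst
    · exact Primrec.eq.comp (Nat.Partrec.Code.primrec_evaln.comp
        ((Primrec.fst.comp Primrec.snd).pair Primrec.fst))
        (Primrec.option_some.comp (Primrec.snd.comp (Primrec.snd.comp Primrec.snd)))
  exact (primrecRel_exists_lt h).comp (Primrec.succ.comp (Primrec.snd.comp Primrec.snd)) Primrec.id

theorem SeenKept.mem_pathSet {s k n x : ℕ} (h : SeenKept s (truePath k) n x) : x ∈ pathSet k n := by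
  obtain ⟨r, -, hr, hx⟩ := h
  have := Nat.Partrec.Code.evaln_sound hx
  rw [(enumerates_pathFun k).2, Part.mem_some_iff] at this
  exact ⟨r, hr, this.symm⟩

theorem seenKept_of_mem {s k n x : ℕ} (h : x ∈ pathSet k n) (hs : HaltsUpTo s (truePath k) x) :
    SeenKept s (truePath k) n x := by
  obtain ⟨r, hr, rfl⟩ := h
  -- an increasing enumeration lists `x` at a rank at most `x`
  have hle : r ≤ pathFun k r := (enumerates_pathFun k).1.le_apply
  obtain ⟨y, hy⟩ := Option.isSome_iff_exists.1 (hs r (by omega))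
  have := Nat.Partrec.Code.evaln_sound hy
  rw [(enumerates_pathFun k).2, Part.mem_some_iff] at this
  exact ⟨r, by omega, hr, this ▸ hy⟩

theorem exists_haltsUpTo_truePath (k x : ℕ) : ∃ s, HaltsUpTo s (truePath k) x :=
  exists_haltsUpTo fun r _ => by rw [(enumerates_pathFun k).2]; trivial

theorem pathSet_computable (k n : ℕ) : ComputablePred (· ∈ pathSet k n) := by
  have hs : PrimrecRel fun x s : ℕ => SeenKept s (truePath k) n x :=
    seenKept_primrec.comp ((Primrec.snd.pair (Primrec.const _)).pair
      ((Primrec.const n).pair Primrec.fst))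
  have hh : PrimrecRel fun x s : ℕ => HaltsUpTo s (truePath k) x :=
    haltsUpTo_primrec.comp ((Primrec.snd.pair (Primrec.const _)).pair Primrec.fst)
  refine ComputablePred.computable_iff_re_compl_re'.2
    ⟨(rePred_exists_nat hs).of_eq fun x => ⟨fun ⟨s, h⟩ => h.mem_pathSet, fun h => ?_⟩,
      (rePred_exists_nat (P := fun x s : ℕ => HaltsUpTo s (truePath k) x ∧
        ¬ SeenKept s (truePath k) n x) (hh.and hs.not)).of_eq fun x =>
        ⟨fun ⟨s, hs, h⟩ hx => h (seenKept_of_mem hx hs), fun h => ?_⟩⟩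
  · obtain ⟨s, hs⟩ := exists_haltsUpTo_truePath k x
    exact ⟨s, seenKept_of_mem h hs⟩
  · obtain ⟨s, hs⟩ := exists_haltsUpTo_truePath k x
    exact ⟨s, hs, fun h' => h h'.mem_pathSet⟩

/-! ### Guesses at the true path -/

/-- The enumeration reached at level `j` by a guess `σ` at the true path; the entry `1` at
position `j` guesses that the elements with value `1` can be enumerated forever. -/
noncomputable def node (σ : List ℕ) : ℕ → Code
  | 0 => Code.id
  | j + 1 => if σ.getD j 0 = 1 then hitCode (node σ j) j else evenCode (node σ j)

theorem node_primrec : Primrec₂ node := by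
  have hstep : Primrec₂ fun (a : List ℕ × ℕ) (b : ℕ × Code) =>
      if a.1.getD b.1 0 = 1 then hitCode b.2 b.1 else evenCode b.2 := by
    refine Primrec.ite ?_ ?_ ?_
    · exact Primrec.eq.comp ((Primrec.list_getD 0).comp (Primrec.fst.comp Primrec.fst)
        (Primrec.fst.comp Primrec.snd)) (Primrec.const 1)
    · exact hitCode_primrec.comp (Primrec.snd.comp Primrec.snd) (Primrec.fst.comp Primrec.snd)
    · exact evenCode_primrec.comp (Primrec.snd.comp Primrec.snd)
  refine (Primrec.nat_rec' (f := fun a : List ℕ × ℕ => a.2) Primrec.snd (Primrec.const Code.id)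
    hstep).of_eq fun a => ?_
  obtain ⟨σ, j⟩ := a
  induction j with
  | zero => rfl
  | succ j ih =>
    simp only [node] at ih ⊢
    rw [← ih]

/-- A guess `(σ, k, i)`: the true path goes along `σ` up to level `k`, and wherever `σ` does not
claim an infinite set of elements with value `1`, the enumeration of these elements diverges
at some rank `≤ i`. -/
abbrev Guess : Type := List ℕ × ℕ × ℕ

/-- At stage `s`, the guess looks correct and demands that `x` be removed from the `n`-th set. -/
def Removes (g : Guess) (n x s : ℕ) : Prop :=
  (∀ j < g.2.1 + 1, HaltsUpTo s (node g.1 j) x) ∧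
  (∀ j < g.2.1, g.1.getD j 0 = 1 ∨ ¬ HaltsUpTo s (hitCode (node g.1 j) j) g.2.2) ∧
  ¬ SeenKept s (node g.1 g.2.1) n x

theorem removes_primrec :
    PrimrecPred fun a : (Guess × ℕ) × (ℕ × ℕ) => Removes a.1.1 a.1.2 a.2.1 a.2.2 := by
  have hg : Primrec fun a : (Guess × ℕ) × (ℕ × ℕ) => a.1.1 := Primrec.fst.comp Primrec.fst
  have hσ : Primrec fun a : (Guess × ℕ) × (ℕ × ℕ) => a.1.1.1 := Primrec.fst.comp hg
  have hk : Primrec fun a : (Guess × ℕ) × (ℕ × ℕ) => a.1.1.2.1 :=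
    Primrec.fst.comp (Primrec.snd.comp hg)
  have hi : Primrec fun a : (Guess × ℕ) × (ℕ × ℕ) => a.1.1.2.2 :=
    Primrec.snd.comp (Primrec.snd.comp hg)
  have hn : Primrec fun a : (Guess × ℕ) × (ℕ × ℕ) => a.1.2 := Primrec.snd.comp Primrec.fst
  have hx : Primrec fun a : (Guess × ℕ) × (ℕ × ℕ) => a.2.1 := Primrec.fst.comp Primrec.snd
  have hs : Primrec fun a : (Guess × ℕ) × (ℕ × ℕ) => a.2.2 := Primrec.snd.comp Primrec.snd
  have hnode : Primrec fun b : ℕ × ((Guess × ℕ) × (ℕ × ℕ)) => node b.2.1.1.1 b.1 :=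
    node_primrec.comp (hσ.comp Primrec.snd) Primrec.fst
  have h1 : PrimrecRel fun (j : ℕ) (a : (Guess × ℕ) × (ℕ × ℕ)) =>
      HaltsUpTo a.2.2 (node a.1.1.1 j) a.2.1 :=
    haltsUpTo_primrec.comp (((hs.comp Primrec.snd).pair hnode).pair (hx.comp Primrec.snd))
  have h2 : PrimrecRel fun (j : ℕ) (a : (Guess × ℕ) × (ℕ × ℕ)) =>
      a.1.1.1.getD j 0 = 1 ∨ ¬ HaltsUpTo a.2.2 (hitCode (node a.1.1.1 j) j) a.1.1.2.2 := by
    refine PrimrecPred.or ?_ (PrimrecPred.not ?_)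
    · exact Primrec.eq.comp ((Primrec.list_getD 0).comp (hσ.comp Primrec.snd) Primrec.fst)
        (Primrec.const 1)
    · exact haltsUpTo_primrec.comp (((hs.comp Primrec.snd).pair
        (hitCode_primrec.comp hnode Primrec.fst)).pair (hi.comp Primrec.snd))
  refine ((primrecRel_forall_lt h1).comp (Primrec.succ.comp hk) Primrec.id).and
    (((primrecRel_forall_lt h2).comp hk Primrec.id).and (PrimrecPred.not ?_))
  exact seenKept_primrec.comp ((hs.pair (node_primrec.comp hσ hk)).pair (hn.pair hx))

/-- The guess never looks wrong, and its enumerations are total. By induction on the level, it then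
follows the true path. -/
def Correct (g : Guess) : Prop :=
  (∀ j ≤ g.2.1, ∀ r, (eval (node g.1 j) r).Dom) ∧
  ∀ j < g.2.1, g.1.getD j 0 = 1 ∨ ∃ r ≤ g.2.2, ¬ (eval (hitCode (node g.1 j) j) r).Dom

theorem Correct.node_eq {g : Guess} (h : Correct g) {j : ℕ} (hj : j ≤ g.2.1) :
    node g.1 j = truePath j := by
  induction j with
  | zero => rfl
  | succ j ih =>
    have ih := ih (by omega)
    have hd := h.1 (j + 1) hj
    have hg := h.2 j (by omega)
    rw [node, ih] at hd
    rw [ih] at hg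
    rw [node, truePath, ih]
    by_cases h1 : g.1.getD j 0 = 1
    · rw [if_pos h1] at hd
      rw [if_pos h1, if_pos hd]
    · obtain ⟨r, -, hr⟩ := hg.resolve_left h1
      rw [if_neg h1, if_neg fun hall => hr (hall r)]

/-- A correct guess removes exactly the complement of the intermediate set of its level. -/
theorem Correct.removes_iff {g : Guess} (h : Correct g) (n x : ℕ) :
    (∃ s, Removes g n x s) ↔ x ∉ pathSet g.2.1 n := by
  have hk := h.node_eq le_rfl
  constructor
  · rintro ⟨s, h1, -, h3⟩ hx
    have hs := h1 g.2.1 (Nat.lt_succ_self _)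
    rw [hk] at h3 hs
    exact h3 (seenKept_of_mem hx hs)
  · intro hx
    choose t ht using fun j => exists_haltsUpTo_truePath j x
    refine ⟨(Finset.range (g.2.1 + 1)).sup t, fun j hj => ?_, fun j hj => ?_, fun h' => hx ?_⟩
    · rw [h.node_eq (by omega)]
      exact (ht j).mono (Finset.le_sup (Finset.mem_range.2 hj)) le_rfl
    · exact (h.2 j hj).imp_right fun ⟨r, hr, hnd⟩ hs => hnd (hs.dom hr)
    · rw [hk] at h'
      exact h'.mem_pathSet

/-- Incorrect guesses do only finite damage: either one of their enumerations is undefined at some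
`r`, which blocks the removal of all `x ≥ r`, or they look wrong from some stage `t` on, and before
that stage only numbers below `t` have been considered. -/
theorem finite_of_not_correct {g : Guess} (h : ¬ Correct g) (n : ℕ) :
    {x | ∃ s, Removes g n x s}.Finite := by
  rw [Correct, not_and_or] at h
  push Not at h
  rcases h with ⟨j, hj, r, hr⟩ | ⟨j, hj, h1, hd⟩
  · refine (Set.finite_lt_nat r).subset ?_
    rintro x ⟨s, hs, -⟩
    by_contra hx
    exact hr ((hs j (by omega)).dom (not_lt.1 hx))
  · obtain ⟨t, ht⟩ := exists_haltsUpTo hd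
    refine (Set.finite_lt_nat t).subset ?_
    rintro x ⟨s, hs, hg, -⟩
    have hst : s < t := by
      by_contra hst
      exact (hg j hj).resolve_left h1 (ht.mono (not_lt.1 hst) le_rfl)
    exact (hs 0 (Nat.succ_pos _)).lt.trans hst

/-- Every level of the true path is correctly guessed: `i` only has to bound one point of divergence
for each of the finitely many levels below where the enumeration of hits is partial. -/
theorem exists_correct (k : ℕ) : ∃ g : Guess, Correct g ∧ g.2.1 = k := by
  classical
  have hb : ∀ j, ∃ i, (∀ r, (eval (hitCode (truePath j) j) r).Dom) ∨
      ¬ (eval (hitCode (truePath j) j) i).Dom := fun j => by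
    by_cases h : ∀ r, (eval (hitCode (truePath j) j) r).Dom
    · exact ⟨0, Or.inl h⟩
    · obtain ⟨i, hi⟩ := not_forall.1 h
      exact ⟨i, Or.inr hi⟩
  choose b hb using hb
  set σ : List ℕ := (List.range k).map fun j =>
    if ∀ r, (eval (hitCode (truePath j) j) r).Dom then 1 else 0 with hσ
  have hget : ∀ j < k, σ.getD j 0 =
      if ∀ r, (eval (hitCode (truePath j) j) r).Dom then 1 else 0 := fun j hj => by
    simp [hσ, hj]
  have hnode : ∀ j ≤ k, node σ j = truePath j := fun j hj => by
    induction j with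
    | zero => rfl
    | succ j ih =>
      rw [node, truePath, ih (by omega), hget j (by omega)]
      split_ifs <;> simp_all
  refine ⟨(σ, k, (Finset.range k).sup b), ⟨fun j hj r => ?_, fun j hj => ?_⟩, rfl⟩
  · rw [hnode j hj, (enumerates_pathFun j).2]
    trivial
  · dsimp only at hj ⊢
    rw [hnode j hj.le, hget j hj]
    by_cases h : ∀ r, (eval (hitCode (truePath j) j) r).Dom
    · exact Or.inl (if_pos h)
    · exact Or.inr ⟨b j, Finset.le_sup (Finset.mem_range.2 hj), (hb j).resolve_left h⟩

/-! ### The base -/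

/-- The `n`-th set of the base: the `n`-th intermediate set of level `0`, diminished by the demands
of the first `n` guesses. -/
def baseSet (n : ℕ) : Set ℕ :=
  {x | Kept n x ∧ ∀ m < n, ∀ s, ¬ Removes (Denumerable.ofNat Guess m) n x s}

theorem baseSet_zero : baseSet 0 = Set.univ :=
  Set.eq_univ_of_forall fun x => ⟨kept_zero x, fun _ hm => absurd hm (Nat.not_lt_zero _)⟩

theorem Removes.succ {g : Guess} {n x s : ℕ} (h : Removes g n x s) : Removes g (n + 1) x s :=
  ⟨h.1, h.2.1, fun ⟨r, hr, hk, he⟩ => h.2.2 ⟨r, hr, hk.of_succ, he⟩⟩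

theorem baseSet_succ_subset (n : ℕ) : baseSet (n + 1) ⊆ baseSet n := fun _ hx =>
  ⟨hx.1.of_succ, fun m hm s hs => hx.2 m (by omega) s hs.succ⟩

/-- The levels of the true path correctly guessed by one of the first `n` guesses, and level `0`. -/
def Guessed (n k : ℕ) : Prop :=
  k = 0 ∨ ∃ m < n, Correct (Denumerable.ofNat Guess m) ∧ (Denumerable.ofNat Guess m).2.1 = k

theorem Guessed.baseSet_subset {n l k : ℕ} (h : Guessed n k) (hl : n ≤ l) :
    baseSet l ⊆ pathSet k l := by
  intro x hx
  rcases h with rfl | ⟨m, hm, hc, rfl⟩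
  · exact ⟨x, hx.1, by rw [pathFun_zero, id]⟩
  · by_contra hnot
    obtain ⟨s, hs⟩ := (hc.removes_iff l x).2 hnot
    exact hx.2 m (by omega) s hs

theorem exists_max_guessed (n : ℕ) : ∃ k, Guessed n k ∧ ∀ l, Guessed n l → l ≤ k := by
  have hfin : {k | Guessed n k}.Finite := by
    refine ((Set.finite_singleton 0).union
      ((Set.finite_lt_nat n).image fun m => (Denumerable.ofNat Guess m).2.1)).subset ?_
    rintro k (rfl | ⟨m, hm, -, rfl⟩)
    · exact Or.inl rfl
    · exact Or.inr ⟨m, hm, rfl⟩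
  obtain ⟨k, hk, hmax⟩ := hfin.exists_maximal ⟨0, Or.inl rfl⟩
  exact ⟨k, hk, fun l hl => (le_total l k).elim id (hmax hl)⟩

/-- Up to finitely many elements, `baseSet n` is the `n`-th intermediate set of the largest level
correctly guessed so far. -/
theorem exists_baseSet_eq (n : ℕ) :
    ∃ k, Guessed n k ∧ (pathSet k n \ baseSet n).Finite := by
  obtain ⟨k, hk, hmax⟩ := exists_max_guessed n
  refine ⟨k, hk, ?_⟩
  have hm : ∀ m < n, (pathSet k n ∩
      {x | ∃ s, Removes (Denumerable.ofNat Guess m) n x s}).Finite := fun m hm => by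
    by_cases hc : Correct (Denumerable.ofNat Guess m)
    · convert! Set.finite_empty
      rw [Set.eq_empty_iff_forall_notMem]
      rintro x ⟨hx, hs⟩
      exact (hc.removes_iff n x).1 hs (pathSet_antitone_level (hmax _ (Or.inr ⟨m, hm, hc, rfl⟩)) hx)
    · exact (finite_of_not_correct hc n).subset Set.inter_subset_right
  refine ((Set.finite_lt_nat n).biUnion hm).subset ?_
  rintro x ⟨hx, hnot⟩
  have hkept : Kept n x := by
    obtain ⟨r, hr, hrx⟩ := pathSet_antitone_level (Nat.zero_le k) hx
    rw [pathFun_zero, id] at hrx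
    exact hrx ▸ hr
  have : ∃ m < n, ∃ s, Removes (Denumerable.ofNat Guess m) n x s := by
    by_contra hno
    push Not at hno
    exact hnot ⟨hkept, hno⟩
  obtain ⟨m, hmn, hs⟩ := this
  exact Set.mem_biUnion hmn ⟨hx, hs⟩

theorem baseSet_computable (n : ℕ) : ComputablePred (· ∈ baseSet n) := by
  obtain ⟨k, hk, hfin⟩ := exists_baseSet_eq n
  refine computablePred_of_finite_diff (pathSet_computable k n) hfin ?_
  rw [Set.sdiff_eq_empty.2 (hk.baseSet_subset le_rfl)]
  exact Set.finite_empty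

/-- The drop is infinite even when no new level has been reached: for the largest level `k` guessed
so far, `baseSet (n + 1)` lies in `pathSet k (n + 1)`, whether or not a higher level is guessed at
`n + 1`. -/
theorem infinite_baseSet_diff (n : ℕ) : (baseSet n \ baseSet (n + 1)).Infinite := by
  obtain ⟨k, hk, hfin⟩ := exists_baseSet_eq n
  refine ((infinite_pathSet_diff k n).sdiff hfin).mono ?_
  rintro x ⟨⟨hx, hx'⟩, hnot⟩
  exact ⟨by_contra fun h => hnot ⟨hx, h⟩, fun h => hx' (hk.baseSet_subset (Nat.le_succ n) h)⟩

theorem exists_baseSet_decides {R : Set ℕ} (hR : ComputablePred (· ∈ R)) :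
    ∃ n, (baseSet n \ Rᶜ).Finite ∨ (baseSet n \ R).Finite := by
  obtain ⟨k, hk⟩ := exists_pathFun_decides hR
  obtain ⟨g, hg, rfl⟩ := exists_correct k
  have hguess : Guessed (Encodable.encode g + 1) g.2.1 :=
    Or.inr ⟨Encodable.encode g, Nat.lt_succ_self _,
      by rwa [Denumerable.ofNat_encode], by rw [Denumerable.ofNat_encode]⟩
  have hsub := (hguess.baseSet_subset le_rfl).trans (pathSet_subset_range _ _)
  exact ⟨_, hk.imp (fun h => h.subset (Set.sdiff_subset_sdiff_left hsub))
    fun h => h.subset (Set.sdiff_subset_sdiff_left hsub)⟩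

/-! ### Coding the base into one set -/

theorem cantorPair_inj {x n y m : ℕ} (h : cantorPair x n = cantorPair y m) : x = y ∧ n = m := by
  -- `cantorPair x n` lies in the block of the `x + n + 1` values following `(x+n)(x+n+1)/2`
  have key : ∀ a b c d : ℕ, a + b < c + d → cantorPair a b < cantorPair c d := by
    intro a b c d hlt
    obtain ⟨t, ht⟩ := Nat.even_mul_succ_self (a + b)
    obtain ⟨u, hu⟩ := Nat.even_mul_succ_self (c + d)
    have hmul : (a + b + 1) * (a + b + 2) ≤ (c + d) * (c + d + 1) :=
      Nat.mul_le_mul (by omega) (by omega)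
    have hexp : (a + b + 1) * (a + b + 2) = (a + b) * (a + b + 1) + 2 * (a + b + 1) := by ring
    unfold cantorPair
    omega
  have hsum : x + n = y + m := by
    rcases lt_trichotomy (x + n) (y + m) with hlt | heq | hgt
    · exact absurd h (key _ _ _ _ hlt).ne
    · exact heq
    · exact absurd h (key _ _ _ _ hgt).ne'
  unfold cantorPair at h
  rw [hsum] at h
  omega

theorem cantorPair_primrec : Primrec₂ cantorPair := by
  have hsum : Primrec fun a : ℕ × ℕ => a.1 + a.2 := Primrec.nat_add.comp Primrec.fst Primrec.snd
  exact Primrec.nat_add.comp (Primrec.nat_div.comp (Primrec.nat_mul.comp hsum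
    (Primrec.succ.comp hsum)) (Primrec.const 2)) Primrec.snd

/-- The set with columns `baseSet n`. -/
def base : Set ℕ := {z | ∀ x n, z = cantorPair x n → x ∈ baseSet n}

theorem column_base (n : ℕ) : column base n = baseSet n := by
  ext x
  refine ⟨fun h => h x n rfl, fun h y m hy => ?_⟩
  obtain ⟨rfl, rfl⟩ := cantorPair_inj hy
  exact h

theorem base_isCoCE : IsCoCE base := by
  have hdec : Primrec fun b : ℕ × ℕ => Denumerable.ofNat ((ℕ × ℕ) × (ℕ × ℕ)) b.2 :=
    (Primrec.ofNat _).comp Primrec.snd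
  have hP : PrimrecPred fun c : ℕ × ((ℕ × ℕ) × (ℕ × ℕ)) =>
      c.1 = cantorPair c.2.1.1 c.2.1.2 ∧ (¬ Kept c.2.1.2 c.2.1.1 ∨
        (c.2.2.1 < c.2.1.2 ∧
          Removes (Denumerable.ofNat Guess c.2.2.1) c.2.1.2 c.2.1.1 c.2.2.2)) := by
    have hx : Primrec fun c : ℕ × ((ℕ × ℕ) × (ℕ × ℕ)) => c.2.1.1 :=
      Primrec.fst.comp (Primrec.fst.comp Primrec.snd)
    have hn : Primrec fun c : ℕ × ((ℕ × ℕ) × (ℕ × ℕ)) => c.2.1.2 :=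
      Primrec.snd.comp (Primrec.fst.comp Primrec.snd)
    have hm : Primrec fun c : ℕ × ((ℕ × ℕ) × (ℕ × ℕ)) => c.2.2.1 :=
      Primrec.fst.comp (Primrec.snd.comp Primrec.snd)
    have hs : Primrec fun c : ℕ × ((ℕ × ℕ) × (ℕ × ℕ)) => c.2.2.2 :=
      Primrec.snd.comp (Primrec.snd.comp Primrec.snd)
    exact (Primrec.eq.comp Primrec.fst (cantorPair_primrec.comp hx hn)).and
      ((kept_primrec.comp hn hx).not.or ((Primrec.nat_lt.comp hm hn).and
        (removes_primrec.comp ((((Primrec.ofNat Guess).comp hm).pair hn).pair (hx.pair hs)))))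
  refine (rePred_exists_nat (PrimrecPred.primrecRel
    (hP.comp (Primrec.fst.pair hdec)))).of_eq fun z => ?_
  constructor
  · rintro ⟨w, hz, hw⟩ hb
    obtain ⟨hk, hr⟩ := hb _ _ hz
    rcases hw with hw | ⟨hm, hw⟩
    · exact hw hk
    · exact hr _ hm _ hw
  · intro hz
    have : ∃ x n, z = cantorPair x n ∧ x ∉ baseSet n := by
      by_contra hno
      push Not at hno
      exact hz hno
    obtain ⟨x, n, hxn, hx⟩ := this
    by_cases hk : Kept n x
    · have : ∃ m < n, ∃ s, Removes (Denumerable.ofNat Guess m) n x s := by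
        by_contra hno
        push Not at hno
        exact hx ⟨hk, hno⟩
      obtain ⟨m, hm, s, hs⟩ := this
      refine ⟨Encodable.encode ((x, n), (m, s)), ?_⟩
      rw [Denumerable.ofNat_encode]
      exact ⟨hxn, Or.inr ⟨hm, hs⟩⟩
    · refine ⟨Encodable.encode ((x, n), (0, 0)), ?_⟩
      rw [Denumerable.ofNat_encode]
      exact ⟨hxn, Or.inl hk⟩

end UltrafilterBase

theorem theorem5p4 :
    ∃ F : Set ℕ, UltrafilterBase.IsCoCE F ∧
      UltrafilterBase.IsUltrafilterBase UltrafilterBase.computableSets F := by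
  refine ⟨UltrafilterBase.base, UltrafilterBase.base_isCoCE, ⟨?_, ?_, ?_, ?_⟩, ?_⟩
  · intro n
    rw [UltrafilterBase.column_base]
    exact UltrafilterBase.baseSet_computable n
  · rw [UltrafilterBase.column_base, UltrafilterBase.baseSet_zero]
  · intro n
    rw [UltrafilterBase.column_base, UltrafilterBase.column_base, UltrafilterBase.AlmostSubset,
      Set.sdiff_eq_empty.2 (UltrafilterBase.baseSet_succ_subset n)]
    exact Set.finite_empty
  · intro n
    rw [UltrafilterBase.column_base, UltrafilterBase.column_base]
    exact UltrafilterBase.infinite_baseSet_diff n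
  · intro R hR
    obtain ⟨n, hn⟩ := UltrafilterBase.exists_baseSet_decides hR
    refine ⟨n, ?_⟩
    rw [UltrafilterBase.column_base]
    exact hn
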